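/- Lemma (spectral projections). Let $\mathcal A$ be a unital $C^*$-algebra and $\mathcal E$ a Hilbert $\mathcal A$-module, whose $\mathcal A$-valued scalar product $\langle\cdot|\cdot\rangle$ is linear in the second entry. Let $\mathcal L_{\mathcal A}(\mathcal E)$ be the $C^*$-algebra of adjointable operators on $\mathcal E$, let $\mathcal F_{\mathcal A}(\mathcal E)$ be the span of the operators $\pi_{x,y}\colon z\mapsto x\langle y|z\rangle$ ($x,y\in\mathcal E$), and let $\mathcal K_{\mathcal A}(\mathcal E)=\overline{\mathcal F_{\mathcal A}(\mathcal E)}$ be the algebra of $\mathcal A$-compact operators. An unbounded $\mathcal A$-linear operator $D$ on $\mathcal E$ is called $\mathcal A$-elliptic if it is densely defined, is regular (that is, $D^*$ is densely defined and $1+D^*D$ has dense range), and has $\mathcal A$-compact resolvent, $(1+D^*D)^{-1}\in\mathcal K_{\mathcal A}(\mathcal E)$. The spectrum $\operatorname{spec}D$ is the set of $z\in\mathbb C$ for which $D-z$ has no inverse in $\mathcal L_{\mathcal A}(\mathcal E)$. Let $D$ be a self-adjoint ($D=D^*$) $\mathcal A$-elliptic operator and let $\lambda_1\le\lambda_2$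 be real numbers with $\lambda_1,\lambda_2\notin\operatorname{spec}D$. Then the spectral projection $P_{[\lambda_1,\lambda_2]}=1_{[\lambda_1,\lambda_2]}(D)\in\mathcal L_{\mathcal A}(\mathcal E)$, defined by continuous functional calculus since the endpoints are not in the spectrum, satisfies $P_{[\lambda_1,\lambda_2]}=P_{(\lambda_1,\lambda_2]}=P_{[\lambda_1,\lambda_2)}$ and is $\mathcal A$-compact: $P_{[\lambda_1,\lambda_2]}\in\mathcal K_{\mathcal A}(\mathcal E)$. Moreover, let $\tau$ be any normalized faithful trace on $\mathcal A$, let $\operatorname{tr}_\tau$ be the trace on $\mathcal F_{\mathcal A}(\mathcal E)$ with $\operatorname{tr}_\tau(\pi_{x,y})=\tau(\langle y|x\rangle)$, extended to positive $T\in\mathcal L_{\mathcal A}(\mathcal E)$ by $\operatorname{tr}_\tau(T)=\sup\{\operatorname{tr}_\tau(F): F\in\mathcal F_{\mathcal A}(\mathcal E),\ 0\le F\le T\}\in[0,\infty]$, and let $\mathcal L^1_{\mathcal A}(\mathcal E,\operatorname{tr}_\tau)=\{T\in\mathcal L_{\mathcal A}(\mathcal E): \operatorname{tr}_\tau(|T|)<\infty\}$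 be the trace class ideal. If $e^{-tD^2}\in\mathcal L^1_{\mathcal A}(\mathcal E,\operatorname{tr}_\tau)$ for some $t>0$, then $P_{[\lambda_1,\lambda_2]}\in\mathcal L^1_{\mathcal A}(\mathcal E,\operatorname{tr}_\tau)$. -/

import Mathlib

open scoped InnerProductSpace ENNReal ComplexOrder

noncomputable section

set_option linter.unusedSectionVars false

namespace HilbertCStar

/-! Hilbert C⋆-modules are Mathlib's `CStarModule`: the `A`-valued scalar product `⟪x, y⟫_A` is
complex linear and `A`-linear in the second entry.  Scalars of `A` are written on the left there,
so that `x ⟨y, z⟩` reads `⟪y, z⟫_A • x`.  With scalars written on the right this is precisely a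
right Hilbert module over the opposite C⋆-algebra of `A`; as `A` runs over all unital C⋆-algebras,
so does its opposite, with the same norm, order and traces. -/

section Adjointable

variable (A : Type*) {E : Type*} [CStarAlgebra A] [PartialOrder A] [StarOrderedRing A]
  [NormedAddCommGroup E] [NormedSpace ℂ E] [Module A E] [CStarModule A E]

lemma ext_inner {u v : E} (h : ∀ x : E, ⟪x, u⟫_A = ⟪x, v⟫_A) : u = v := by
  have h1 : ⟪u - v, u - v⟫_A = 0 := by
    rw [CStarModule.inner_sub_right, h, sub_self]
  exact sub_eq_zero.mp (CStarModule.inner_self.mp h1)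

variable (E)

/-- The bounded operators `T` on `E` that have a bounded adjoint for the `A`-valued scalar
product. -/
def adjointableSubalgebra : Subalgebra ℂ (E →L[ℂ] E) where
  carrier := {T | ∃ S : E →L[ℂ] E, ∀ x y : E, ⟪T x, y⟫_A = ⟪x, S y⟫_A}
  mul_mem' := by
    rintro T₁ T₂ ⟨S₁, h₁⟩ ⟨S₂, h₂⟩
    exact ⟨S₂ * S₁, fun x y => by
      simp only [mul_apply_eq_comp, h₁, h₂]⟩
  add_mem' := by
    rintro T₁ T₂ ⟨S₁, h₁⟩ ⟨S₂, h₂⟩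
    exact ⟨S₁ + S₂, fun x y => by
      simp only [add_apply, CStarModule.inner_add_left,
        CStarModule.inner_add_right, h₁, h₂]⟩
  algebraMap_mem' := fun c => ⟨(starRingEnd ℂ c) • 1, fun x y => by
    simp [Algebra.algebraMap_eq_smul_one]⟩

/-- The C⋆-algebra `L_A(E)` of adjointable operators on `E`. -/
abbrev Adjointable : Type _ := ↥(adjointableSubalgebra A E)

variable {A E}

/-- The adjoint of an adjointable operator. -/
instance : Star (Adjointable A E) where
  star T := ⟨T.2.choose, (T : E →L[ℂ] E), fun x y => by
    rw [← CStarModule.star_inner, ← T.2.choose_spec, CStarModule.star_inner]⟩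

lemma inner_apply_left (T : Adjointable A E) (x y : E) :
    ⟪(T : E →L[ℂ] E) x, y⟫_A = ⟪x, (star T : Adjointable A E).1 y⟫_A :=
  T.2.choose_spec x y

lemma eq_star_of_inner (T S : Adjointable A E)
    (h : ∀ x y : E, ⟪(T : E →L[ℂ] E) x, y⟫_A = ⟪x, S.1 y⟫_A) : star T = S := by
  apply Subtype.ext
  ext y
  exact ext_inner A fun x => by rw [← inner_apply_left, h]

instance : StarRing (Adjointable A E) where
  star_involutive T := eq_star_of_inner _ _ fun x y => by
    rw [← CStarModule.star_inner, ← inner_apply_left, CStarModule.star_inner]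
  star_mul T S := eq_star_of_inner _ _ fun x y => by
    change ⟪T.1 (S.1 x), y⟫_A = ⟪x, (star S).1 ((star T).1 y)⟫_A
    rw [inner_apply_left, inner_apply_left]
  star_add T S := eq_star_of_inner _ _ fun x y => by
    change ⟪T.1 x + S.1 x, y⟫_A = ⟪x, (star T).1 y + (star S).1 y⟫_A
    rw [CStarModule.inner_add_left, CStarModule.inner_add_right, inner_apply_left,
      inner_apply_left]

instance : StarModule ℂ (Adjointable A E) where
  star_smul c T := eq_star_of_inner _ _ fun x y => by
    change ⟪c • T.1 x, y⟫_A = ⟪x, star c • (star T).1 y⟫_A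
    rw [CStarModule.inner_smul_left_complex, CStarModule.inner_smul_right_complex,
      inner_apply_left]

instance : CStarRing (Adjointable A E) where
  norm_mul_self_le T := by
    have h : ‖T.1‖ ≤ √‖(star T * T).1‖ := by
      refine ContinuousLinearMap.opNorm_le_bound _ (Real.sqrt_nonneg _) fun x => ?_
      have h1 : ‖T.1 x‖ ^ 2 ≤ ‖(star T * T).1‖ * ‖x‖ ^ 2 := by
        rw [CStarModule.norm_sq_eq A, inner_apply_left]
        calc ‖⟪x, (star T).1 (T.1 x)⟫_A‖ ≤ ‖x‖ * ‖(star T * T).1 x‖ :=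
              CStarModule.norm_inner_le E
          _ ≤ ‖x‖ * (‖(star T * T).1‖ * ‖x‖) := by
              gcongr
              exact ContinuousLinearMap.le_opNorm _ _
          _ = _ := by ring
      calc ‖T.1 x‖ = √(‖T.1 x‖ ^ 2) := (Real.sqrt_sq (norm_nonneg _)).symm
        _ ≤ √(‖(star T * T).1‖ * ‖x‖ ^ 2) := Real.sqrt_le_sqrt h1
        _ = √‖(star T * T).1‖ * ‖x‖ := by
            rw [Real.sqrt_mul (norm_nonneg _), Real.sqrt_sq (norm_nonneg _)]
    calc ‖T‖ * ‖T‖ ≤ √‖(star T * T).1‖ * √‖(star T * T).1‖ :=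
          mul_self_le_mul_self (norm_nonneg _) h
      _ = ‖star T * T‖ := Real.mul_self_sqrt (norm_nonneg _)

instance [CompleteSpace E] : CompleteSpace (Adjointable A E) := by
  refine Metric.complete_of_cauchySeq_tendsto fun u hu => ?_
  have hu1 : CauchySeq fun n => (u n).1 :=
    uniformContinuous_subtype_val.comp_cauchySeq hu
  have hu2 : CauchySeq fun n => (star (u n) : Adjointable A E).1 :=
    (uniformContinuous_subtype_val.comp
      (starNormedAddGroupHom (E := Adjointable A E)).uniformContinuous).comp_cauchySeq hu
  obtain ⟨T, hT⟩ := cauchySeq_tendsto_of_complete hu1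
  obtain ⟨S, hS⟩ := cauchySeq_tendsto_of_complete hu2
  refine ⟨⟨T, S, fun x y => ?_⟩, tendsto_subtype_rng.mpr hT⟩
  have hTx : Filter.Tendsto (fun n => (u n).1 x) Filter.atTop (nhds (T x)) :=
    ((ContinuousLinearMap.apply ℂ E x).continuous.tendsto T).comp hT
  have hSy : Filter.Tendsto (fun n => (star (u n) : Adjointable A E).1 y) Filter.atTop
      (nhds (S y)) :=
    ((ContinuousLinearMap.apply ℂ E y).continuous.tendsto S).comp hS
  have h1 : Filter.Tendsto (fun n => ⟪(u n).1 x, y⟫_A) Filter.atTop (nhds ⟪T x, y⟫_A) :=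
    ((CStarModule.continuous_inner (A := A) (E := E)).tendsto (T x, y)).comp
      (hTx.prodMk_nhds tendsto_const_nhds)
  have h2 : Filter.Tendsto (fun n => ⟪x, (star (u n) : Adjointable A E).1 y⟫_A) Filter.atTop
      (nhds ⟪x, S y⟫_A) :=
    ((CStarModule.continuous_inner (A := A) (E := E)).tendsto (x, S y)).comp
      (tendsto_const_nhds.prodMk_nhds hSy)
  simp only [inner_apply_left] at h1
  exact tendsto_nhds_unique h1 h2

instance [CompleteSpace E] : CStarAlgebra (Adjointable A E) where

/-- The usual order of the C⋆-algebra `L_A(E)`: `S ≤ T` iff `T - S` is positive. -/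
instance [CompleteSpace E] : PartialOrder (Adjointable A E) := CStarAlgebra.spectralOrder _

instance [CompleteSpace E] : StarOrderedRing (Adjointable A E) :=
  CStarAlgebra.spectralOrderedRing _

end Adjointable

section Compact

variable {A E : Type*} [CStarAlgebra A] [PartialOrder A] [StarOrderedRing A]
  [NormedAddCommGroup E] [NormedSpace ℂ E] [Module A E] [CStarModule A E]

lemma complex_smul_smul (c : ℂ) (a : A) (x : E) : (c • a) • x = c • (a • x) :=
  ext_inner A fun y => by
    rw [CStarModule.inner_op_smul_right, CStarModule.inner_smul_right_complex,
      CStarModule.inner_op_smul_right, smul_mul_assoc]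

lemma norm_smul_le' (a : A) (x : E) : ‖a • x‖ ≤ ‖a‖ * ‖x‖ := by
  refine abs_le_of_sq_le_sq' ?_ (by positivity) |>.2
  rw [CStarModule.norm_sq_eq A, CStarModule.inner_op_smul_right, CStarModule.inner_op_smul_left]
  calc ‖a * (⟪x, x⟫_A * star a)‖ ≤ ‖a‖ * (‖⟪x, x⟫_A‖ * ‖star a‖) :=
        (norm_mul_le _ _).trans (by gcongr; exact norm_mul_le _ _)
    _ = (‖a‖ * ‖x‖) ^ 2 := by
        rw [norm_star, ← CStarModule.norm_sq_eq A]; ring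

variable (A) in
/-- The bounded operator `z ↦ x ⟨y, z⟩`. -/
def rankOneCLM (x y : E) : E →L[ℂ] E :=
  LinearMap.mkContinuous
    { toFun := fun z => ⟪y, z⟫_A • x
      map_add' := fun u v => by rw [CStarModule.inner_add_right, add_smul]
      map_smul' := fun c u => by
        rw [CStarModule.inner_smul_right_complex, complex_smul_smul, RingHom.id_apply] }
    (‖y‖ * ‖x‖) fun z => by
      calc ‖⟪y, z⟫_A • x‖ ≤ ‖⟪y, z⟫_A‖ * ‖x‖ := norm_smul_le' _ _
        _ ≤ ‖y‖ * ‖z‖ * ‖x‖ := by gcongr; exact CStarModule.norm_inner_le E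
        _ = _ := by ring

variable (A) in
/-- The adjointable operator `π_{x,y} : z ↦ x ⟨y, z⟩`. -/
def rankOne (x y : E) : Adjointable A E :=
  ⟨rankOneCLM A x y, rankOneCLM A y x, fun u v => by
    change ⟪⟪y, u⟫_A • x, v⟫_A = ⟪u, ⟪x, v⟫_A • y⟫_A
    rw [CStarModule.inner_op_smul_left, CStarModule.inner_op_smul_right, CStarModule.star_inner]⟩

variable (A E)

/-- The `A`-finite operators `F_A(E)`: the complex span of the operators `π_{x,y}`. -/
def finiteOps : Submodule ℂ (Adjointable A E) :=
  Submodule.span ℂ (Set.range fun p : E × E => rankOne A p.1 p.2)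

/-- The `A`-compact operators `K_A(E)`: the norm closure of `F_A(E)` in `L_A(E)`. -/
def compactOps : Submodule ℂ (Adjointable A E) := (finiteOps A E).topologicalClosure

end Compact

section Unbounded

variable {A E : Type*} [CStarAlgebra A] [PartialOrder A] [StarOrderedRing A]
  [NormedAddCommGroup E] [NormedSpace ℂ E] [Module A E] [CStarModule A E]

/-- The pairs `(y, z)` with `⟨D x, y⟩ = ⟨x, z⟩` for all `x` in the domain of `D`. -/
def adjointGraph (D : E →ₗ.[A] E) : Submodule A (E × E) where
  carrier := {p | ∀ x : D.domain, ⟪D x, p.1⟫_A = ⟪(x : E), p.2⟫_A}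
  add_mem' := fun {p q} hp hq x => by
    rw [Prod.fst_add, Prod.snd_add, CStarModule.inner_add_right, CStarModule.inner_add_right,
      hp x, hq x]
  zero_mem' := fun x => by simp
  smul_mem' := fun a p hp x => by
    rw [Prod.smul_fst, Prod.smul_snd, CStarModule.inner_op_smul_right,
      CStarModule.inner_op_smul_right, hp x]

/-- The adjoint `D*` of an unbounded operator `D` (meaningful if `D` is densely defined): its
domain consists of the `y` for which there is `z` with `⟨D x, y⟩ = ⟨x, z⟩` for all `x` in the
domain of `D`, and then `D* y = z`. -/
def adjoint (D : E →ₗ.[A] E) : E →ₗ.[A] E := (adjointGraph D).toLinearPMap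

/-- `D` is self-adjoint: it is densely defined and `D* = D`. -/
structure IsSelfAdjointOp (D : E →ₗ.[A] E) : Prop where
  dense_domain : Dense (D.domain : Set E)
  adjoint_eq : adjoint D = D

/-- `A`-elliptic operators: densely defined, regular (`D*` is densely defined and `1 + D* D` has
dense range), with `A`-compact resolvent `(1 + D* D)⁻¹`.  The latter is the (unique) bounded
operator `S` with `S (1 + D* D) x = x` for all `x` in the domain of `D* D`. -/
structure IsElliptic (D : E →ₗ.[A] E) : Prop where
  dense_domain : Dense (D.domain : Set E)
  dense_adjoint_domain : Dense ((adjoint D).domain : Set E)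
  dense_range : Dense {y : E | ∃ (x : D.domain) (hx : D x ∈ (adjoint D).domain),
    (x : E) + adjoint D ⟨D x, hx⟩ = y}
  compact_resolvent : ∃ S ∈ compactOps A E, ∀ (x : D.domain) (hx : D x ∈ (adjoint D).domain),
    S.1 ((x : E) + adjoint D ⟨D x, hx⟩) = x

/-- `R ∈ L_A(E)` is a two-sided inverse of `D - z`. -/
def IsResolventAt (D : E →ₗ.[A] E) (z : ℂ) (R : Adjointable A E) : Prop :=
  (∀ x : D.domain, R.1 (D x - z • (x : E)) = x) ∧
    ∀ y : E, ∃ x : D.domain, (x : E) = R.1 y ∧ D x - z • (x : E) = y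

/-- The spectrum of `D`: the complex numbers `z` such that `D - z` has no inverse in `L_A(E)`. -/
def spec (D : E →ₗ.[A] E) : Set ℂ := {z | ¬ ∃ R : Adjointable A E, IsResolventAt D z R}

open scoped Classical in
/-- The resolvent `(D - z)⁻¹` for `z` outside the spectrum of `D` (and `0` otherwise). -/
def resolvent (D : E →ₗ.[A] E) (z : ℂ) : Adjointable A E :=
  if h : ∃ R : Adjointable A E, IsResolventAt D z R then h.choose else 0

variable [CompleteSpace E]

/-- Functional calculus of a self-adjoint regular operator `D` for functions `f : ℝ → ℂ` which
are continuous on the spectrum of `D` and vanish at infinity, reduced to the continuous functional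
calculus of the normal element `(D + i)⁻¹` of the C⋆-algebra `L_A(E)`: under `w = (x + i)⁻¹`, that
is `x = w⁻¹ - i`, the function `f` becomes `w ↦ f (w⁻¹ - i)`, with value `0` at `w = 0` (the point
`x = ∞`). -/
def functionalCalculus (D : E →ₗ.[A] E) (f : ℝ → ℂ) : Adjointable A E :=
  cfc (fun w : ℂ => if w = 0 then 0 else f (w⁻¹ - Complex.I).re) (resolvent D (-Complex.I))

/-- The spectral projection `P_I = 1_I(D)` for a bounded interval `I` whose endpoints are not in
the spectrum of `D`. -/
def spectralProjection (D : E →ₗ.[A] E) (I : Set ℝ) : Adjointable A E :=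
  functionalCalculus D (I.indicator fun _ => 1)

/-- The operator `exp(-t D²)`, for `t > 0`. -/
def heatOperator (D : E →ₗ.[A] E) (t : ℝ) : Adjointable A E :=
  functionalCalculus D fun x => (Real.exp (-t * x ^ 2) : ℂ)

end Unbounded

section Trace

variable {A E : Type*} [CStarAlgebra A] [PartialOrder A] [StarOrderedRing A]
  [NormedAddCommGroup E] [NormedSpace ℂ E] [Module A E] [CStarModule A E]

/-- `τ` is a normalized faithful trace on `A`. -/
structure IsFaithfulTrace (τ : A →ₚ[ℂ] ℂ) : Prop where
  map_one : τ 1 = 1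
  map_mul_comm : ∀ a b : A, τ (a * b) = τ (b * a)
  faithful : ∀ a : A, τ (star a * a) = 0 → a = 0

variable [CompleteSpace E]

/-- The extension of the trace `tr_τ(∑ π_{x_i, y_i}) = ∑ τ(⟨y_i, x_i⟩)` from the positive
`A`-finite operators to the positive elements `T` of `L_A(E)`, with values in `[0, ∞]`:
the supremum of `tr_τ(F)` over all `A`-finite operators `F` with `0 ≤ F ≤ T`. -/
def traceExt (τ : A →ₚ[ℂ] ℂ) (T : Adjointable A E) : ℝ≥0∞ :=
  ⨆ (n : ℕ) (x : Fin n → E) (y : Fin n → E)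
    (_ : 0 ≤ ∑ i, rankOne A (x i) (y i) ∧ ∑ i, rankOne A (x i) (y i) ≤ T),
    ENNReal.ofReal (∑ i, τ ⟪y i, x i⟫_A).re

/-- `T` is in the trace class ideal `L¹_A(E, tr_τ)` of `L_A(E)`: `tr_τ(|T|) < ∞`. -/
def IsTraceClass (τ : A →ₚ[ℂ] ℂ) (T : Adjointable A E) : Prop :=
  traceExt τ (CFC.abs T) < ∞

end Trace

end HilbertCStar

end

set_option linter.unusedSectionVars false

/-! Everything is reduced to bounded operators through the resolvent `R = (D + i)⁻¹`. For `z = ±i`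
the cross terms cancel in `⟨(D - z)x, (D - z)x⟩ = ⟨Dx, Dx⟩ + ⟨x, x⟩`, so `D - z` is bounded below.
Its range contains that of `1 + D² = (D - z)(D + z)`, hence is dense, and it is closed because `D`
is closed. Thus both inverses exist and are adjoint to each other.

The resolvent identity makes `R` normal, with `R - R* = -2i R R*`. Hence its nonzero spectrum
consists of points `w = (x + i)⁻¹` with `x` real, and a function continuous at these `x` and
vanishing at infinity becomes continuous on the spectrum of `R`. A real `l` outside the spectrum of
`D` is not such an `x` (`IsResolventAt.inv_notMem_spectrum`), so the indicator of an interval with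
such endpoints is admissible, and including or omitting an endpoint changes nothing.

Compactness comes from `f(D) = (f · (1 + x²))(D) · R R*`: here `R R* = (1 + D*D)⁻¹` is compact and
the compact operators form a left ideal. For an indicator the first factor is bounded, its function
having bounded support. The trace class claim follows from `1_{[a,b]}(x) ≤ e^{t(a² + b²)} e^{-t x²}`
and the monotonicity and homogeneity of the extended trace. -/

namespace HilbertCStar

/-! ### Self-adjoint operators and the existence of the resolvents at `±i`. -/

section SelfAdjoint

variable {A E : Type*} [CStarAlgebra A] [PartialOrder A] [StarOrderedRing A]
  [NormedAddCommGroup E] [NormedSpace ℂ E] [Module A E] [CStarModule A E]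

/-- The domain of an unbounded operator is a complex subspace, on which it is complex linear. -/
lemma exists_domain_complex_smul (D : E →ₗ.[A] E) (c : ℂ) (x : D.domain) :
    ∃ y : D.domain, (y : E) = c • (x : E) ∧ D y = c • D x := by
  refine ⟨(c • (1 : A)) • x, ?_, ?_⟩
  · rw [Submodule.coe_smul, complex_smul_smul, one_smul]
  · rw [LinearPMap.map_smul, complex_smul_smul, one_smul]

lemma eq_zero_of_dense_inner {s : Set E} (hs : Dense s) {z : E}
    (h : ∀ x ∈ s, ⟪x, z⟫_A = 0) : z = 0 := by
  have hc : Continuous fun x : E => ⟪x, z⟫_A :=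
    (CStarModule.continuous_inner (A := A) (E := E)).comp (continuous_id.prodMk continuous_const)
  have h0 := Continuous.ext_on hs hc continuous_const h
  exact CStarModule.inner_self.mp (congrFun h0 z)

variable {D : E →ₗ.[A] E}

/-- Density of the domain makes `adjointGraph D` single-valued, so `adjoint D` loses no information.
-/
lemma adjoint_graph (hD : Dense (D.domain : Set E)) : (adjoint D).graph = adjointGraph D := by
  refine Submodule.toLinearPMap_graph_eq _ fun p hp h0 => ?_
  refine eq_zero_of_dense_inner (A := A) hD fun x hx => ?_
  have := hp ⟨x, hx⟩
  rw [h0, CStarModule.inner_zero_right] at this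
  exact this.symm

namespace IsSelfAdjointOp

variable (hsa : IsSelfAdjointOp D)
include hsa

lemma graph_eq : D.graph = adjointGraph D := by
  conv_lhs => rw [← hsa.adjoint_eq]
  exact adjoint_graph hsa.dense_domain

lemma exists_of_inner {y z : E} (h : ∀ x : D.domain, ⟪D x, y⟫_A = ⟪(x : E), z⟫_A) :
    ∃ x : D.domain, (x : E) = y ∧ D x = z := by
  have : (y, z) ∈ D.graph := by
    rw [hsa.graph_eq]
    exact h
  simpa using (LinearPMap.mem_graph_iff D).mp this

lemma inner_comm (x y : D.domain) : ⟪D x, (y : E)⟫_A = ⟪(x : E), D y⟫_A := by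
  have h : ((y : E), D y) ∈ adjointGraph D := by
    rw [← hsa.graph_eq]
    exact D.mem_graph y
  exact h x

/-- `D` is closed. -/
lemma exists_of_tendsto {u : ℕ → D.domain} {y z : E}
    (hu : Filter.Tendsto (fun n => (u n : E)) Filter.atTop (nhds y))
    (hDu : Filter.Tendsto (fun n => D (u n)) Filter.atTop (nhds z)) :
    ∃ x : D.domain, (x : E) = y ∧ D x = z := by
  refine hsa.exists_of_inner fun x => ?_
  have h1 := ((CStarModule.continuous_inner (A := A) (E := E)).tendsto (D x, y)).comp
    (tendsto_const_nhds.prodMk_nhds hu)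
  have h2 := ((CStarModule.continuous_inner (A := A) (E := E)).tendsto ((x : E), z)).comp
    (tendsto_const_nhds.prodMk_nhds hDu)
  refine tendsto_nhds_unique h1 (h2.congr fun n => ?_)
  exact (hsa.inner_comm x (u n)).symm

/-- As `z` is imaginary and `D` symmetric, the cross terms cancel and leave `⟨Dx, Dx⟩ + ⟨x, x⟩ ≥ ⟨x,
x⟩`. This gives injectivity, closed range and the bound on the inverse of `D - z`. -/
lemma norm_le_norm_sub {z : ℂ} (hz : z = Complex.I ∨ z = -Complex.I) (x : D.domain) :
    ‖(x : E)‖ ≤ ‖D x - z • (x : E)‖ := by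
  have h1 : star z * z = 1 := by rcases hz with rfl | rfl <;> simp
  have h2 : star z = -z := by rcases hz with rfl | rfl <;> simp
  have key : ⟪D x - z • (x : E), D x - z • (x : E)⟫_A = ⟪D x, D x⟫_A + ⟪(x : E), x⟫_A := by
    simp only [CStarModule.inner_sub_left, CStarModule.inner_sub_right,
      CStarModule.inner_smul_left_complex, CStarModule.inner_smul_right_complex]
    rw [hsa.inner_comm, smul_sub, smul_smul, mul_comm z, h1, h2, one_smul, neg_smul]
    abel
  refine abs_le_of_sq_le_sq' ?_ (norm_nonneg _) |>.2
  rw [CStarModule.norm_sq_eq A, CStarModule.norm_sq_eq A, key]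
  exact CStarAlgebra.norm_le_norm_of_nonneg_of_le CStarModule.inner_self_nonneg
    (le_add_of_nonneg_left CStarModule.inner_self_nonneg)

lemma isResolventAt_star {z : ℂ} {R : Adjointable A E} (hR : IsResolventAt D z R) :
    IsResolventAt D (star z) (star R) := by
  constructor
  · intro x
    refine ext_inner A fun y => ?_
    obtain ⟨x', hx', hy⟩ := hR.2 y
    rw [← inner_apply_left, ← hx', CStarModule.inner_sub_right,
      CStarModule.inner_smul_right_complex, ← hsa.inner_comm, ← CStarModule.inner_smul_left_complex,
      ← CStarModule.inner_sub_left, hy]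
  · intro y
    -- The second entry is the value `D` must take at `R* y` if `(D - z̄) R* y = y`;
    -- self-adjointness puts `R* y` into the domain.
    obtain ⟨x, hx, hDx⟩ := hsa.exists_of_inner (y := (star R).1 y)
      (z := y + star z • (star R).1 y) fun x => by
        have h := inner_apply_left R (D x - z • (x : E)) y
        rw [hR.1, CStarModule.inner_sub_left, CStarModule.inner_smul_left_complex] at h
        rw [CStarModule.inner_add_right, CStarModule.inner_smul_right_complex, h]
        abel
    exact ⟨x, hx, by rw [hDx, hx, add_sub_cancel_right]⟩

variable [CompleteSpace E]

/-- If `1 + D²` has dense range, then `D ± i` is onto. -/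
lemma surjective_sub (hd : Dense {y : E | ∃ (x : D.domain) (hx : D x ∈ (adjoint D).domain),
    (x : E) + adjoint D ⟨D x, hx⟩ = y}) {z : ℂ} (hz : z = Complex.I ∨ z = -Complex.I) (y : E) :
    ∃ x : D.domain, D x - z • (x : E) = y := by
  have hzz : z * z = -1 := by rcases hz with rfl | rfl <;> simp
  have hd' : Dense {y : E | ∃ x : D.domain, D x - z • (x : E) = y} := by
    refine hd.mono ?_
    rintro _ ⟨x, hx, rfl⟩
    have hg : (D x, adjoint D ⟨D x, hx⟩) ∈ D.graph := by
      rw [hsa.graph_eq, ← adjoint_graph hsa.dense_domain]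
      exact (adjoint D).mem_graph ⟨D x, hx⟩
    obtain ⟨v, hv, hDv⟩ := (LinearPMap.mem_graph_iff D).mp hg
    obtain ⟨w, hw, hDw⟩ := exists_domain_complex_smul D z x
    -- `v + w = (D + z) x`, and `(D - z)(D + z) x = D² x - z² x = x + D² x`.
    refine ⟨v + w, ?_⟩
    dsimp only at hv hDv
    rw [LinearPMap.map_add, Submodule.coe_add, hDw, hw, hDv, hv, smul_add, smul_smul, hzz,
      neg_smul, one_smul]
    abel
  obtain ⟨v, hv, hvy⟩ := mem_closure_iff_seq_limit.mp (hd' y)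
  choose u hu using hv
  -- The images under `D - z` converge and `D - z` is bounded below, so the preimages are Cauchy;
  -- closedness of `D` then handles the limit.
  have hcau : CauchySeq fun n => (u n : E) := by
    rw [Metric.cauchySeq_iff]
    intro ε hε
    obtain ⟨N, hN⟩ := Metric.cauchySeq_iff.mp hvy.cauchySeq ε hε
    refine ⟨N, fun m hm n hn => lt_of_le_of_lt ?_ (hN m hm n hn)⟩
    rw [dist_eq_norm, dist_eq_norm, ← hu m, ← hu n]
    have := hsa.norm_le_norm_sub hz (u m - u n)
    rw [LinearPMap.map_sub, Submodule.coe_sub, smul_sub] at this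
    refine this.trans_eq (congrArg _ ?_)
    abel
  obtain ⟨x, hx⟩ := cauchySeq_tendsto_of_complete hcau
  obtain ⟨x', hx', hDx'⟩ := hsa.exists_of_tendsto hx
    (((hvy.add (hx.const_smul z)).congr fun n => by rw [← hu n, sub_add_cancel]))
  exact ⟨x', by rw [hDx', hx', add_sub_cancel_right]⟩

/-- If `1 + D²` has dense range, then `D ± i` has a bounded two-sided inverse. -/
lemma exists_clm_inverse (hd : Dense {y : E | ∃ (x : D.domain) (hx : D x ∈ (adjoint D).domain),
    (x : E) + adjoint D ⟨D x, hx⟩ = y}) {z : ℂ} (hz : z = Complex.I ∨ z = -Complex.I) :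
    ∃ R : E →L[ℂ] E, (∀ x : D.domain, R (D x - z • (x : E)) = x) ∧
      ∀ y : E, ∃ x : D.domain, (x : E) = R y ∧ D x - z • (x : E) = y := by
  choose r hr using fun y => hsa.surjective_sub hd hz y
  have inj : ∀ x x' : D.domain, D x - z • (x : E) = D x' - z • (x' : E) → x = x' := by
    intro x x' h
    have h' := hsa.norm_le_norm_sub hz (x - x')
    rw [LinearPMap.map_sub, Submodule.coe_sub, smul_sub, sub_sub_sub_comm, h, sub_self, norm_zero,
      norm_le_zero_iff, sub_eq_zero] at h'
    exact Subtype.ext h'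
  refine ⟨LinearMap.mkContinuous
    { toFun := fun y => (r y : E)
      map_add' := fun y y' => ?_
      map_smul' := fun c y => ?_ } 1 fun y => ?_, fun x => ?_, fun y => ⟨r y, rfl, hr y⟩⟩
  · rw [← Submodule.coe_add]
    refine congrArg _ (inj _ _ ?_)
    rw [hr, LinearPMap.map_add, Submodule.coe_add, smul_add, add_sub_add_comm, hr, hr]
  · obtain ⟨w, hw, hDw⟩ := exists_domain_complex_smul D c (r y)
    rw [RingHom.id_apply, ← hw]
    refine congrArg _ (inj _ _ ?_)
    rw [hr, hDw, hw, smul_comm z c, ← smul_sub, hr]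
  · have := hsa.norm_le_norm_sub hz (r y)
    rw [hr] at this
    simpa using this
  · exact congrArg (fun u : D.domain => (u : E)) (inj _ _ (hr _))

lemma exists_isResolventAt_neg_I
    (hd : Dense {y : E | ∃ (x : D.domain) (hx : D x ∈ (adjoint D).domain),
      (x : E) + adjoint D ⟨D x, hx⟩ = y}) :
    ∃ R : Adjointable A E, IsResolventAt D (-Complex.I) R := by
  obtain ⟨R, hR1, hR2⟩ := hsa.exists_clm_inverse hd (Or.inr rfl)
  obtain ⟨Q, -, hQ2⟩ := hsa.exists_clm_inverse hd (Or.inl rfl)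
  -- The adjoint of `(D + i)⁻¹` is `(D - i)⁻¹`: writing `x = (D + i)u` and `y = (D - i)v` turns the
  -- claim into the symmetry of `D`.
  refine ⟨⟨R, Q, fun x y => ?_⟩, hR1, hR2⟩
  obtain ⟨u, hu, hux⟩ := hR2 x
  obtain ⟨v, hv, hvy⟩ := hQ2 y
  rw [← hu, ← hv, ← hux, ← hvy]
  simp only [CStarModule.inner_sub_left, CStarModule.inner_sub_right,
    CStarModule.inner_smul_left_complex, CStarModule.inner_smul_right_complex, hsa.inner_comm]
  simp

end IsSelfAdjointOp

lemma resolvent_isResolventAt {z : ℂ} (h : ∃ R : Adjointable A E, IsResolventAt D z R) :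
    IsResolventAt D z (resolvent D z) := by
  rw [resolvent, dif_pos h]
  exact h.choose_spec

/-- The resolvent identity. -/
lemma IsResolventAt.sub_eq {z w : ℂ} {R Q : Adjointable A E} (hR : IsResolventAt D z R)
    (hQ : IsResolventAt D w Q) : R - Q = (z - w) • (R * Q) := by
  apply Subtype.ext
  ext y
  change R.1 y - Q.1 y = (z - w) • R.1 (Q.1 y)
  obtain ⟨x, hx, hy⟩ := hQ.2 y
  have h2 : y = (D x - z • (x : E)) + (z - w) • (x : E) := by
    rw [← hy, sub_smul]; abel
  conv_lhs => rw [h2, map_add, hR.1, map_smul, ← h2, ← hx]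
  rw [← hx, add_sub_cancel_left]

end SelfAdjoint
end HilbertCStar
namespace HilbertCStar

/-! ### The left ideal of compact operators. -/

section Ideal

variable {A E : Type*} [CStarAlgebra A] [PartialOrder A] [StarOrderedRing A]
  [NormedAddCommGroup E] [NormedSpace ℂ E] [Module A E] [CStarModule A E]

lemma Adjointable.map_smul_left (T : Adjointable A E) (a : A) (x : E) :
    T.1 (a • x) = a • T.1 x := by
  refine ext_inner A fun y => ?_
  have h : ∀ v, ⟪y, T.1 v⟫_A = ⟪(star T).1 y, v⟫_A := fun v => by
    rw [inner_apply_left, star_star]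
  rw [h, CStarModule.inner_op_smul_right, CStarModule.inner_op_smul_right, h]

lemma mul_rankOne (T : Adjointable A E) (x y : E) :
    T * rankOne A x y = rankOne A (T.1 x) y := by
  apply Subtype.ext
  ext z
  exact T.map_smul_left _ _

lemma mul_mem_finiteOps (T : Adjointable A E) {S : Adjointable A E} (hS : S ∈ finiteOps A E) :
    T * S ∈ finiteOps A E := by
  refine Submodule.span_induction ?_ ?_ ?_ ?_ hS
  · rintro _ ⟨p, rfl⟩
    dsimp only
    rw [mul_rankOne]
    exact Submodule.subset_span ⟨(T.1 p.1, p.2), rfl⟩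
  · rw [mul_zero]; exact zero_mem _
  · intro S S' _ _ h h'
    rw [mul_add]; exact add_mem h h'
  · intro c S _ h
    rw [mul_smul_comm]; exact Submodule.smul_mem _ _ h

/-- The `A`-compact operators form a left ideal. -/
lemma mul_mem_compactOps (T : Adjointable A E) {S : Adjointable A E} (hS : S ∈ compactOps A E) :
    T * S ∈ compactOps A E :=
  map_mem_closure (continuous_const_mul T) hS fun _ h => mul_mem_finiteOps T h

end Ideal

/-! ### Normality, spectrum and compactness properties of the resolvent. -/

section Resolvent

variable {A E : Type*} [CStarAlgebra A] [PartialOrder A] [StarOrderedRing A]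
  [NormedAddCommGroup E] [NormedSpace ℂ E] [Module A E] [CStarModule A E] {D : E →ₗ.[A] E}

/-- `R - R* = -2i R R*` for the resolvent `R = (D + i)⁻¹` of a self-adjoint `D`. -/
lemma IsSelfAdjointOp.sub_star_eq (hsa : IsSelfAdjointOp D) {R : Adjointable A E}
    (hR : IsResolventAt D (-Complex.I) R) :
    R - star R = (-2 * Complex.I) • (R * star R) := by
  rw [hR.sub_eq (hsa.isResolventAt_star hR)]
  congr 1
  simp
  ring

/-- The resolvent identity, applied in both orders to `R` and `R*`, expresses the same difference
through `R R*` and through `R* R`. -/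
lemma IsSelfAdjointOp.isStarNormal_of_isResolventAt (hsa : IsSelfAdjointOp D)
    {R : Adjointable A E} (hR : IsResolventAt D (-Complex.I) R) : IsStarNormal R := by
  have h1 := hsa.sub_star_eq hR
  have h2 := (hsa.isResolventAt_star hR).sub_eq hR
  have h3 : star R - R = (2 * Complex.I) • (star R * R) := by
    rw [h2]
    congr 1
    simp
    ring
  have h4 : (2 * Complex.I) • (star R * R) = (2 * Complex.I) • (R * star R) := by
    rw [← h3, ← neg_sub, h1, ← neg_smul]
    congr 1
    ring
  exact ⟨smul_right_injective _ (by simp : (2 * Complex.I) ≠ 0) h4⟩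

/-- The spectrum of `(D + i)⁻¹` consists of `0` and of numbers `(x + i)⁻¹` with `x` real. -/
lemma IsSelfAdjointOp.inv_sub_I_of_mem_spectrum [CompleteSpace E] (hsa : IsSelfAdjointOp D)
    {R : Adjointable A E} (hR : IsResolventAt D (-Complex.I) R) {w : ℂ} (hw : w ∈ spectrum ℂ R)
    (hw0 : w ≠ 0) : (((w⁻¹ - Complex.I).re : ℝ) : ℂ) = w⁻¹ - Complex.I := by
  have hN := hsa.isStarNormal_of_isResolventAt hR
  -- The relation `R - R* = -2i R R*`, read in the functional calculus, holds pointwise on the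
  -- spectrum; dividing by `w w̄` shows that `w⁻¹ - i` is real.
  have h1 : cfc (fun w : ℂ => w - star w) R
      = cfc (fun w : ℂ => (-2 * Complex.I) * (w * star w)) R := by
    rw [cfc_sub (fun w : ℂ => w) (fun w : ℂ => star w) R, cfc_const_mul _ _ R,
      cfc_mul (fun w : ℂ => w) (fun w : ℂ => star w) R, cfc_id' ℂ R, cfc_star_id R]
    exact hsa.sub_star_eq hR
  have h2 := eqOn_of_cfc_eq_cfc h1 (by fun_prop) (by fun_prop) hN hw
  have hs0 : star w ≠ 0 := star_ne_zero.mpr hw0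
  have h3 : star (w⁻¹) - w⁻¹ = -2 * Complex.I := by
    dsimp only at h2
    rw [star_inv₀]
    field_simp
    linear_combination h2
  refine Complex.conj_eq_iff_re.mp ?_
  rw [map_sub, Complex.conj_I]
  change star (w⁻¹) - _ = _
  linear_combination h3

lemma IsResolventAt.inv_notMem_spectrum {R : Adjointable A E}
    (hR : IsResolventAt D (-Complex.I) R) {l : ℂ} (hl : l ∉ spec D) (hl' : l + Complex.I ≠ 0) :
    (l + Complex.I)⁻¹ ∉ spectrum ℂ R := by
  obtain ⟨Q, hQ⟩ := not_not.mp hl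
  have h1 := hR.sub_eq hQ
  have h2 := hQ.sub_eq hR
  have e1 : R - Q = (-(l + Complex.I)) • (R * Q) := by
    rw [h1]; congr 1; ring
  have e2 : Q - R = (l + Complex.I) • (Q * R) := by
    rw [h2]; congr 1; ring
  set c := l + Complex.I with hc
  rw [spectrum.notMem_iff]
  -- With `R = (x + i)⁻¹`, `Q = (x - l)⁻¹` and `c = l + i`, one has formally `(c⁻¹ - (x + i)⁻¹)⁻¹ =
  -- c(x + i)/(x - l) = c(1 + cQ)`.
  refine ⟨⟨algebraMap ℂ _ c⁻¹ - R, c • (1 + c • Q), ?_, ?_⟩, rfl⟩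
  · rw [Algebra.algebraMap_eq_smul_one]
    have : (c⁻¹ • (1 : Adjointable A E) - R) * (c • (1 + c • Q))
        = (1 : Adjointable A E) + c • (Q - R - c • (R * Q)) := by
      simp only [sub_mul, mul_add, smul_add, smul_sub, mul_smul_comm, smul_mul_assoc, mul_one,
        one_mul, smul_smul]
      rw [mul_assoc, mul_inv_cancel₀ hl', mul_one, one_smul]
      abel
    rw [this, ← neg_sub R Q, e1]
    simp
  · rw [Algebra.algebraMap_eq_smul_one]
    have : (c • (1 + c • Q)) * (c⁻¹ • (1 : Adjointable A E) - R)
        = (1 : Adjointable A E) + c • (Q - R - c • (Q * R)) := by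
      simp only [mul_sub, add_mul, smul_add, smul_sub, mul_smul_comm, smul_mul_assoc, mul_one,
        one_mul, smul_smul]
      rw [← mul_assoc, inv_mul_cancel₀ hl', one_mul, one_smul]
      abel
    rw [this, e2]
    simp

/-- For the resolvent `R = (D + i)⁻¹`, the operator `R R*` is `(1 + D* D)⁻¹`, hence compact. -/
lemma IsElliptic.mul_star_self_mem_compactOps (hD : IsElliptic D) (hsa : IsSelfAdjointOp D)
    {R : Adjointable A E} (hR : IsResolventAt D (-Complex.I) R) :
    R * star R ∈ compactOps A E := by
  obtain ⟨S, hS, h⟩ := hD.compact_resolvent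
  suffices R * star R = S from this ▸ hS
  have hR' := hsa.isResolventAt_star hR
  apply Subtype.ext
  refine ContinuousLinearMap.coeFn_injective
    (Continuous.ext_on hD.dense_range (R * star R).1.continuous S.1.continuous ?_)
  rintro _ ⟨x, hx, rfl⟩
  rw [h]
  change R.1 ((star R).1 _) = _
  have hg : (D x, adjoint D ⟨D x, hx⟩) ∈ D.graph := by
    rw [hsa.graph_eq, ← adjoint_graph hsa.dense_domain]
    exact (adjoint D).mem_graph ⟨D x, hx⟩
  obtain ⟨v, hv, hDv⟩ := (LinearPMap.mem_graph_iff D).mp hg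
  dsimp only at hv hDv
  obtain ⟨w, hw, hDw⟩ := exists_domain_complex_smul D Complex.I x
  -- The factorisation `(1 + D²) x = (D - i)(D + i) x`, with `v + w = (D + i) x`; `R*` and then `R`
  -- undo the two factors.
  have : (x : E) + adjoint D ⟨D x, hx⟩
      = D (v + w) - star (-Complex.I) • ((v + w : D.domain) : E) := by
    rw [LinearPMap.map_add, Submodule.coe_add, hDw, hw, hDv, hv, smul_add, smul_smul]
    simp
    abel
  rw [this, hR'.1, Submodule.coe_add, hv, hw]
  have := hR.1 x
  rwa [neg_smul, sub_neg_eq_add] at this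

end Resolvent
end HilbertCStar
namespace HilbertCStar

/-! ### Functional calculus of `D` through its resolvent. -/

section FunctionalCalculus
open Filter Topology Bornology

variable {A E : Type*} [CStarAlgebra A] [PartialOrder A] [StarOrderedRing A]
  [NormedAddCommGroup E] [NormedSpace ℂ E] [Module A E] [CStarModule A E] [CompleteSpace E]
  {D : E →ₗ.[A] E}

/-- The function of the resolvent `w = (x + i)⁻¹` that corresponds to the function `f` of `x`. -/
noncomputable def cayley (f : ℝ → ℂ) (w : ℂ) : ℂ := if w = 0 then 0 else f (w⁻¹ - Complex.I).re

lemma functionalCalculus_eq (f : ℝ → ℂ) :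
    functionalCalculus D f = cfc (cayley f) (resolvent D (-Complex.I)) := rfl

/-- `x` lies in the part of the real line that is seen by the functional calculus. -/
def IsSpectralValue (D : E →ₗ.[A] E) (x : ℝ) : Prop :=
  ∃ w ∈ spectrum ℂ (resolvent D (-Complex.I)), w ≠ 0 ∧ x = (w⁻¹ - Complex.I).re

lemma continuousOn_cayley (hsa : IsSelfAdjointOp D)
    (hR : IsResolventAt D (-Complex.I) (resolvent D (-Complex.I))) {f : ℝ → ℂ}
    (hf : ∀ x, IsSpectralValue D x → ContinuousAt f x) (h0 : Tendsto f (cobounded ℝ) (𝓝 0)) :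
    ContinuousOn (cayley f) (spectrum ℂ (resolvent D (-Complex.I))) := by
  intro w hw
  by_cases hw0 : w = 0
  · subst hw0
    rw [← continuousWithinAt_sdiff_self, ContinuousWithinAt]
    -- On the spectrum `w⁻¹ - i` is real, so its real part has modulus at least `|w⁻¹| - 1`. For
    -- general `w → 0` the real part could stay bounded.
    have h1 : Tendsto (fun w : ℂ => (w⁻¹ - Complex.I).re)
        (𝓝[spectrum ℂ (resolvent D (-Complex.I)) \ {0}] 0) (cobounded ℝ) := by
      rw [← tendsto_norm_atTop_iff_cobounded]
      have h2 : Tendsto (fun w : ℂ => ‖w⁻¹‖ - 1)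
          (𝓝[spectrum ℂ (resolvent D (-Complex.I)) \ {0}] 0) atTop :=
        tendsto_atTop_add_const_right _ _ (tendsto_norm_cobounded_atTop.comp
          (tendsto_inv₀_nhdsNE_zero.mono_left (nhdsWithin_mono _ fun w hw => hw.2)))
      refine tendsto_atTop_mono' _ ?_ h2
      filter_upwards [self_mem_nhdsWithin] with w hw
      rw [← Complex.norm_real, hsa.inv_sub_I_of_mem_spectrum hR hw.1 hw.2]
      simpa using norm_sub_norm_le w⁻¹ Complex.I
    have h3 : cayley f 0 = 0 := if_pos rfl
    rw [h3]
    refine (h0.comp h1).congr' ?_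
    filter_upwards [self_mem_nhdsWithin] with w hw
    exact (if_neg hw.2).symm
  · refine ContinuousAt.continuousWithinAt ?_
    have h1 : ContinuousAt (fun w : ℂ => (w⁻¹ - Complex.I).re) w :=
      Complex.continuous_re.continuousAt.comp
        ((continuousAt_inv₀ hw0).sub continuousAt_const)
    have h2 : ContinuousAt (fun w : ℂ => f (w⁻¹ - Complex.I).re) w :=
      ContinuousAt.comp (f := fun w : ℂ => (w⁻¹ - Complex.I).re) (g := f)
        (hf _ ⟨w, hw, hw0, rfl⟩) h1
    refine h2.congr ?_
    filter_upwards [isOpen_ne.mem_nhds hw0] with v hv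
    exact (if_neg hv).symm

lemma functionalCalculus_congr {f g : ℝ → ℂ} (h : ∀ x, IsSpectralValue D x → f x = g x) :
    functionalCalculus D f = functionalCalculus D g := by
  rw [functionalCalculus_eq, functionalCalculus_eq]
  refine cfc_congr fun w hw => ?_
  by_cases hw0 : w = 0
  · simp [cayley, hw0]
  · simpa [cayley, hw0] using h _ ⟨w, hw, hw0, rfl⟩

/-- No continuity is needed: where `cfc` is not defined it takes the value `0`. -/
lemma functionalCalculus_nonneg {f : ℝ → ℂ} (h : ∀ x, 0 ≤ f x) :
    0 ≤ functionalCalculus D f := by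
  rw [functionalCalculus_eq]
  refine cfc_nonneg fun w _ => ?_
  unfold cayley
  split_ifs
  exacts [le_rfl, h _]

/-- `f(D)` is compact if `x ↦ f(x) (1 + x²)` is continuous on the spectrum and vanishes at
infinity. -/
lemma functionalCalculus_mem_compactOps (hD : IsElliptic D) (hsa : IsSelfAdjointOp D)
    (hR : IsResolventAt D (-Complex.I) (resolvent D (-Complex.I))) {f : ℝ → ℂ}
    (hf : ∀ x, IsSpectralValue D x → ContinuousAt (fun x => f x * (1 + (x : ℂ) ^ 2)) x)
    (h0 : Tendsto (fun x => f x * (1 + (x : ℂ) ^ 2)) (cobounded ℝ) (𝓝 0)) :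
    functionalCalculus D f ∈ compactOps A E := by
  have hN := hsa.isStarNormal_of_isResolventAt hR
  have hc := continuousOn_cayley hsa hR hf h0
  -- Since `w w̄ = (1 + x²)⁻¹` on the nonzero spectrum, the weight `1 + x²` is exactly compensated
  -- by `R R*`.
  have h1 : functionalCalculus D f = functionalCalculus D (fun x => f x * (1 + (x : ℂ) ^ 2)) *
      (resolvent D (-Complex.I) * star (resolvent D (-Complex.I))) := by
    have h2 : resolvent D (-Complex.I) * star (resolvent D (-Complex.I))
        = cfc (fun w : ℂ => w * star w) (resolvent D (-Complex.I)) := by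
      rw [cfc_mul (fun w : ℂ => w) (fun w : ℂ => star w), cfc_id' ℂ (resolvent D (-Complex.I)),
        cfc_star_id (resolvent D (-Complex.I))]
    rw [h2, functionalCalculus_eq, functionalCalculus_eq, ← cfc_mul _ _ _ hc]
    refine cfc_congr fun w hw => ?_
    by_cases hw0 : w = 0
    · simp [cayley, hw0]
    · have hx := hsa.inv_sub_I_of_mem_spectrum hR hw hw0
      simp only [cayley, if_neg hw0]
      set x := (w⁻¹ - Complex.I).re
      have hw1 : w * ((x : ℂ) + Complex.I) = 1 := by
        rw [hx, sub_add_cancel, mul_inv_cancel₀ hw0]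
      have hw2 : star w * ((x : ℂ) - Complex.I) = 1 := by
        have := congrArg star hw1
        simpa [mul_comm, sub_eq_add_neg] using this
      have hw3 : (1 + (x : ℂ) ^ 2) * (w * star w) = 1 := by
        linear_combination (w * ((x : ℂ) + Complex.I)) * hw2 + hw1 + w * star w * Complex.I_sq
      rw [mul_assoc, hw3, mul_one]
  rw [h1]
  exact mul_mem_compactOps _ (hD.mul_star_self_mem_compactOps hsa hR)

/-- This transfers the hypothesis on the endpoints: the jumps of the indicator occur away from the
points seen by the calculus. -/
lemma IsSpectralValue.ne_of_notMem_spec (hsa : IsSelfAdjointOp D)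
    (hR : IsResolventAt D (-Complex.I) (resolvent D (-Complex.I))) {x l : ℝ}
    (hx : IsSpectralValue D x) (hl : (l : ℂ) ∉ spec D) : x ≠ l := by
  rintro rfl
  obtain ⟨w, hw, hw0, h⟩ := hx
  have h1 := hsa.inv_sub_I_of_mem_spectrum hR hw hw0
  rw [← h] at h1
  have h2 : (x : ℂ) + Complex.I = w⁻¹ := by rw [h1, sub_add_cancel]
  have h3 := hR.inv_notMem_spectrum hl (by rw [h2]; exact inv_ne_zero hw0)
  rw [h2, inv_inv] at h3
  exact h3 hw

lemma continuousAt_indicator_Icc {a b x : ℝ} {g : ℝ → ℂ} (hg : ContinuousAt g x) (ha : x ≠ a)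
    (hb : x ≠ b) : ContinuousAt ((Set.Icc a b).indicator g) x := by
  by_cases h : x ∈ Set.Icc a b
  · refine hg.congr ?_
    filter_upwards [Icc_mem_nhds (lt_of_le_of_ne h.1 ha.symm) (lt_of_le_of_ne h.2 hb)] with y hy
    exact (Set.indicator_of_mem hy g).symm
  · refine (continuousAt_const (y := (0 : ℂ))).congr ?_
    filter_upwards [isClosed_Icc.isOpen_compl.mem_nhds h] with y hy
    exact (Set.indicator_of_notMem hy g).symm

lemma tendsto_indicator_Icc_cobounded (a b : ℝ) (g : ℝ → ℂ) :
    Tendsto ((Set.Icc a b).indicator g) (cobounded ℝ) (𝓝 0) := by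
  refine tendsto_const_nhds.congr' ?_
  filter_upwards [isBounded_def.mp (Metric.isBounded_Icc a b)] with y hy
  exact (Set.indicator_of_notMem hy g).symm

lemma tendsto_exp_neg_mul_sq_cobounded {t : ℝ} (ht : 0 < t) :
    Tendsto (fun x : ℝ => (Real.exp (-t * x ^ 2) : ℂ)) (cobounded ℝ) (𝓝 0) := by
  have h1 : Tendsto (fun x : ℝ => t * ‖x‖ ^ 2) (cobounded ℝ) atTop :=
    ((tendsto_pow_atTop two_ne_zero).comp tendsto_norm_cobounded_atTop).const_mul_atTop ht
  have h2 := (Complex.continuous_ofReal.tendsto 0).comp 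
    (Real.tendsto_exp_neg_atTop_nhds_zero.comp h1)
  rw [Complex.ofReal_zero] at h2
  refine h2.congr fun x => ?_
  simp

end FunctionalCalculus

/-! ### Monotonicity and scaling of the extended trace. -/

section Trace

variable {A E : Type*} [CStarAlgebra A] [PartialOrder A] [StarOrderedRing A]
  [NormedAddCommGroup E] [NormedSpace ℂ E] [Module A E] [CStarModule A E] [CompleteSpace E]

lemma rankOne_smul_left (c : ℂ) (x y : E) : rankOne A (c • x) y = c • rankOne A x y := by
  apply Subtype.ext
  ext z
  change ⟪y, z⟫_A • (c • x) = c • (⟪y, z⟫_A • x)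
  have h : c • x = (c • (1 : A)) • x := by rw [complex_smul_smul, one_smul]
  rw [h, smul_smul, mul_smul_comm, mul_one, complex_smul_smul]

/-- If `0 ≤ F ≤ S ≤ cT` with `F` finite, then `c⁻¹F`, obtained by rescaling the vectors `x i`,
competes in the supremum for `T`. -/
lemma traceExt_le_of_le_smul (τ : A →ₚ[ℂ] ℂ) {S T : Adjointable A E} {c : ℝ} (hc : 0 < c)
    (h : S ≤ (c : ℂ) • T) : traceExt τ S ≤ ENNReal.ofReal c * traceExt τ T := by
  have hc' : (c : ℂ) ≠ 0 := by exact_mod_cast hc.ne'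
  have hci : (0 : ℂ) ≤ (c : ℂ)⁻¹ := by
    rw [← Complex.ofReal_inv]; exact_mod_cast (inv_pos.mpr hc).le
  refine iSup_le fun n => iSup_le fun x => iSup_le fun y => iSup_le fun hF => ?_
  have hsum : ∑ i, rankOne A ((c : ℂ)⁻¹ • x i) (y i) = (c : ℂ)⁻¹ • ∑ i, rankOne A (x i) (y i) := by
    simp_rw [rankOne_smul_left, Finset.smul_sum]
  have hF' : 0 ≤ ∑ i, rankOne A ((c : ℂ)⁻¹ • x i) (y i) ∧
      ∑ i, rankOne A ((c : ℂ)⁻¹ • x i) (y i) ≤ T := by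
    rw [hsum]
    refine ⟨smul_nonneg hci hF.1, ?_⟩
    have := smul_le_smul_of_nonneg_left (hF.2.trans h) hci
    rwa [smul_smul, inv_mul_cancel₀ hc', one_smul] at this
  have h1 : ENNReal.ofReal (∑ i, τ ⟪y i, (c : ℂ)⁻¹ • x i⟫_A).re ≤ traceExt τ T :=
    le_iSup_of_le n (le_iSup_of_le (fun i => (c : ℂ)⁻¹ • x i)
      (le_iSup_of_le y (le_iSup_of_le hF' le_rfl)))
  have h2 : (∑ i, τ ⟪y i, x i⟫_A).re = c * (∑ i, τ ⟪y i, (c : ℂ)⁻¹ • x i⟫_A).re := by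
    simp_rw [CStarModule.inner_smul_right_complex, map_smul]
    rw [← Finset.smul_sum, smul_eq_mul, ← Complex.re_ofReal_mul, ← mul_assoc,
      mul_inv_cancel₀ hc', one_mul]
  rw [h2, ENNReal.ofReal_mul hc.le]
  gcongr

lemma IsTraceClass.of_nonneg_of_le_smul {τ : A →ₚ[ℂ] ℂ} {S T : Adjointable A E} {c : ℝ}
    (hT : IsTraceClass τ T) (hc : 0 < c) (hS : 0 ≤ S) (hT0 : 0 ≤ T) (h : S ≤ (c : ℂ) • T) :
    IsTraceClass τ S := by
  unfold IsTraceClass at *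
  rw [CFC.abs_of_nonneg S hS]
  rw [CFC.abs_of_nonneg T hT0] at hT
  exact (traceExt_le_of_le_smul τ hc h).trans_lt (ENNReal.mul_lt_top ENNReal.ofReal_lt_top hT)

end Trace

/-! ### Comparison of the spectral projection with the heat operator. -/

section SpectralProjection

variable {A E : Type*} [CStarAlgebra A] [PartialOrder A] [StarOrderedRing A]
  [NormedAddCommGroup E] [NormedSpace ℂ E] [Module A E] [CStarModule A E] [CompleteSpace E]
  {D : E →ₗ.[A] E}

lemma spectralProjection_nonneg (I : Set ℝ) : 0 ≤ spectralProjection D I :=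
  functionalCalculus_nonneg fun _ => Set.indicator_nonneg (fun _ _ => zero_le_one) _

lemma heatOperator_nonneg (t : ℝ) : 0 ≤ heatOperator D t :=
  functionalCalculus_nonneg fun x => by exact_mod_cast (Real.exp_pos _).le

/-- For `x` in `[a, b]`, `x²` is at most the larger of `a²` and `b²`, hence at most `a² + b²`; the
constant therefore lifts the Gaussian above `1` on the interval. -/
lemma spectralProjection_le_smul_heatOperator (hsa : IsSelfAdjointOp D)
    (hR : IsResolventAt D (-Complex.I) (resolvent D (-Complex.I))) {a b t : ℝ} (ht : 0 < t)
    (ha : (a : ℂ) ∉ spec D) (hb : (b : ℂ) ∉ spec D) :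
    spectralProjection D (Set.Icc a b)
      ≤ (Real.exp (t * (a ^ 2 + b ^ 2)) : ℂ) • heatOperator D t := by
  have hf := continuousOn_cayley hsa hR (f := (Set.Icc a b).indicator fun _ => 1)
    (fun x hx => continuousAt_indicator_Icc continuousAt_const
      (hx.ne_of_notMem_spec hsa hR ha) (hx.ne_of_notMem_spec hsa hR hb))
    (tendsto_indicator_Icc_cobounded a b _)
  have hg := continuousOn_cayley hsa hR (f := fun x => (Real.exp (-t * x ^ 2) : ℂ))
    (fun x _ => by fun_prop) (tendsto_exp_neg_mul_sq_cobounded ht)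
  rw [spectralProjection, heatOperator, functionalCalculus_eq, functionalCalculus_eq,
    ← cfc_smul _ _ _ hg]
  refine cfc_mono (fun w _ => ?_) hf (hg.const_smul (Real.exp (t * (a ^ 2 + b ^ 2)) : ℂ))
  by_cases hw : w = 0
  · simp [cayley, hw]
  · simp only [cayley, if_neg hw]
    set x := (w⁻¹ - Complex.I).re
    rw [smul_eq_mul, ← Complex.ofReal_mul, ← Real.exp_add]
    by_cases hx : x ∈ Set.Icc a b
    · rw [Set.indicator_of_mem hx]
      have h1 : x ^ 2 ≤ a ^ 2 + b ^ 2 := by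
        rcases le_total 0 x with h | h <;> nlinarith [hx.1, hx.2, sq_nonneg a, sq_nonneg b]
      have h2 : (1 : ℝ) ≤ Real.exp (t * (a ^ 2 + b ^ 2) + -t * x ^ 2) :=
        Real.one_le_exp (by nlinarith)
      exact_mod_cast h2
    · rw [Set.indicator_of_notMem hx]
      exact_mod_cast (Real.exp_pos _).le

end SpectralProjection

end HilbertCStar

theorem mainTheorem9 {A E : Type*} [CStarAlgebra A] [PartialOrder A] [StarOrderedRing A]
    [NormedAddCommGroup E] [NormedSpace ℂ E] [CompleteSpace E] [Module A E] [CStarModule A E]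
    (D : E →ₗ.[A] E) (hD : HilbertCStar.IsElliptic D) (hsa : HilbertCStar.IsSelfAdjointOp D)
    (l₁ l₂ : ℝ) (h₁ : (l₁ : ℂ) ∉ HilbertCStar.spec D) (h₂ : (l₂ : ℂ) ∉ HilbertCStar.spec D)
    (hl : l₁ ≤ l₂) :
    HilbertCStar.spectralProjection D (Set.Icc l₁ l₂) ∈ HilbertCStar.compactOps A E ∧
      HilbertCStar.spectralProjection D (Set.Icc l₁ l₂) =
        HilbertCStar.spectralProjection D (Set.Ioc l₁ l₂) ∧
      HilbertCStar.spectralProjection D (Set.Icc l₁ l₂) =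
        HilbertCStar.spectralProjection D (Set.Ico l₁ l₂) ∧
      ∀ τ : A →ₚ[ℂ] ℂ, HilbertCStar.IsFaithfulTrace τ → ∀ t : ℝ, 0 < t →
        HilbertCStar.IsTraceClass τ (HilbertCStar.heatOperator D t) →
        HilbertCStar.IsTraceClass τ (HilbertCStar.spectralProjection D (Set.Icc l₁ l₂)) := by
  have hR := HilbertCStar.resolvent_isResolventAt (hsa.exists_isResolventAt_neg_I hD.dense_range)
  have hne₁ : ∀ x, HilbertCStar.IsSpectralValue D x → x ≠ l₁ :=
    fun x hx => hx.ne_of_notMem_spec hsa hR h₁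
  have hne₂ : ∀ x, HilbertCStar.IsSpectralValue D x → x ≠ l₂ :=
    fun x hx => hx.ne_of_notMem_spec hsa hR h₂
  refine ⟨?_, ?_, ?_, fun τ _ t ht h => ?_⟩
  -- The weight is absorbed into the indicator: the product keeps bounded support and can jump only
  -- at the endpoints.
  · have hmul : (fun x : ℝ => (Set.Icc l₁ l₂).indicator (fun _ => (1 : ℂ)) x * (1 + (x : ℂ) ^ 2))
        = (Set.Icc l₁ l₂).indicator fun x : ℝ => 1 + (x : ℂ) ^ 2 := by
      ext x
      simp [Set.indicator_apply]
    refine HilbertCStar.functionalCalculus_mem_compactOps hD hsa hR ?_ ?_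
    · rw [hmul]
      exact fun x hx => HilbertCStar.continuousAt_indicator_Icc (by fun_prop) (hne₁ x hx)
        (hne₂ x hx)
    · rw [hmul]
      exact HilbertCStar.tendsto_indicator_Icc_cobounded _ _ _
  · refine HilbertCStar.functionalCalculus_congr fun x hx => ?_
    simp [Set.indicator_apply, lt_iff_le_and_ne, (hne₁ x hx).symm]
  · refine HilbertCStar.functionalCalculus_congr fun x hx => ?_
    simp [Set.indicator_apply, lt_iff_le_and_ne, hne₂ x hx]
  · exact h.of_nonneg_of_le_smul (Real.exp_pos _) (HilbertCStar.spectralProjection_nonneg _)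
      (HilbertCStar.heatOperator_nonneg t)
      (HilbertCStar.spectralProjection_le_smul_heatOperator hsa hR ht h₁ h₂)
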